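/- **Model.** A circuit with $n$ inputs and $k$ output bits is laid out on the planar grid of unit squares. Each node fills one square and has $s$ bits of memory. Each wire joins two nodes and runs along a path of adjacent squares that avoids all other nodes, and each side of a square is crossed by at most one wire. The area $A$ is the number of squares that contain a node or a part of a wire. The circuit runs for $T$ clock cycles. In each cycle, a node may receive one input symbol, sends one bit along each wire incident to it (depending on its memory, the cycle, and its current input symbol), receives one bit along each such wire, updates its memory, and may emit one output bit; the local functions are arbitrary. Each input symbol enters the circuit exactly once and each output bit is emitted once, at a node and a cycle fixed in advance, with at most one input symbol and at most one output bit per node and cycle. The energy is $E = AT$. The output nodes are the nodes that emit at least one output bit; the circuit is output regular if in every clock cycle in which some output node emits a bit, every output node does. **Decoding schemes.** Fix $\epsilon\in(0,1)$ and $s\in\mathbb N$. A decoding scheme is a sequence, indexed by block lengths $n_1<n_2<\cdots$, of encoding functions $\{0,1\}^{k(n)}\to\{0,1\}^{n}$ and circuits with $s$ bits of memory per node, each of which computes a decoding function $\{0,1,?\}^{n}\to\{0,1\}^{k(n)}$. Its block error probability $P_e(n)$ is the probability that the output of the circuit differs from the source, when the source consists of $k(n)$ independent fair bits and its codeword is sent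 over $n$ uses of the binary erasure channel with erasure probability $\epsilon$. For a function $f:\mathbb N\to\mathbb R$ with $f(n)\le 1$ for all sufficiently large $n$, an $f(n)$-decoding scheme is a decoding scheme with $P_e(n)<f(n)$ for all sufficiently large block lengths $n$ of the scheme. **Theorem.** Consider any $f(n)$-decoding scheme whose asymptotic rate $R=\lim k(n)/n$ exists and is positive, all of whose circuits are output regular, and whose number of output nodes increases without bound with $n$. Then its energy satisfies $E(n)=\Omega\bigl(n\,(-\ln f(n))^{1/5}\bigr)$, that is, there is a constant $c>0$ (which may depend on the scheme) such that, for all sufficiently large block lengths $n$ of the scheme, $$A(n)\,T(n)\ \ge\ c\,n\,\bigl(-\ln f(n)\bigr)^{1/5}.$$ -/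

import Mathlib

open Filter Topology

namespace VLSI

/-- The planar grid of unit squares: two squares are adjacent when they share a side. -/
noncomputable abbrev grid : SimpleGraph (ℤ × ℤ) :=
  SimpleGraph.boxProd (SimpleGraph.hasse ℤ) (SimpleGraph.hasse ℤ)

/-- The alphabet of the output of a binary erasure channel: a bit, or an erasure (`none`). -/
abbrev Symbol : Type := Option Bool

/-- A circuit in the Thompson model, with `n` inputs (channel output symbols) and `k` output bits,
in which every node has `s` bits of memory.

Layout. The circuit is laid out on the planar grid of unit squares. A node fills one square.
A wire joins two nodes and runs through a path of adjacent squares, avoiding the squares of all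
other nodes; wires have unit width, so each side of a square is crossed by at most one wire
(two wires can thus meet in a square, and cross there, but they cannot run side by side in it).

Operation. The circuit runs for `cycles` clock cycles, numbered `0, …, cycles - 1`. In each clock
cycle a node may receive one input symbol, it sends one bit along each wire that ends at it, receives
one bit along each such wire, updates its memory, and may produce one output bit. The local functions
of the nodes are arbitrary. Each input symbol enters the circuit exactly once and each output bit is
produced once, at nodes and clock cycles that are fixed in advance. -/
structure Circuit (s n k : ℕ) where
  /-- The squares filled by nodes. -/
  nodes : Finset (ℤ × ℤ)
  numWires : ℕ
  /-- The two end nodes of a wire. -/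
  tail : Fin numWires → nodes
  head : Fin numWires → nodes
  tail_ne_head : ∀ w, tail w ≠ head w
  /-- The route of a wire. -/
  route : ∀ w, grid.Walk (tail w : ℤ × ℤ) (head w : ℤ × ℤ)
  route_isPath : ∀ w, (route w).IsPath
  route_avoids : ∀ w x, x ∈ (route w).support → x ∈ nodes → x = tail w ∨ x = head w
  route_disjoint : ∀ w w', w ≠ w' → List.Disjoint (route w).edges (route w').edges
  /-- The number of clock cycles. -/
  cycles : ℕ
  /-- The initial contents of the memories. -/
  init : nodes → (Fin s → Bool)
  /-- The bit that a node sends along a wire in a given clock cycle, as a function of its memory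
  and of the input symbol (if any) that it receives in that cycle. -/
  send : nodes → ℕ → (Fin s → Bool) → Option Symbol → Fin numWires → Bool
  /-- The new contents of the memory of a node at the end of a given clock cycle, as a function of
  the old contents, of the input symbol (if any) and of the bits received along the wires. -/
  update : ∀ v : nodes, ℕ → (Fin s → Bool) → Option Symbol →
    ({w : Fin numWires // tail w = v ∨ head w = v} → Bool) → (Fin s → Bool)
  /-- The output bit of a node in a given clock cycle. -/
  emit : ∀ v : nodes, ℕ → (Fin s → Bool) → Option Symbol →
    ({w : Fin numWires // tail w = v ∨ head w = v} → Bool) → Bool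
  /-- The index of the input (if any) that a node receives in a given clock cycle. -/
  inputAt : nodes → ℕ → Option (Fin n)
  inputAt_lt : ∀ v t i, inputAt v t = some i → t < cycles
  inputAt_once : ∀ i, ∃! p : nodes × ℕ, inputAt p.1 p.2 = some i
  /-- The node and the clock cycle at which an output bit is produced. -/
  outputAt : Fin k → nodes × ℕ
  outputAt_lt : ∀ i, (outputAt i).2 < cycles
  outputAt_injective : Function.Injective outputAt

namespace Circuit

variable {s n k : ℕ} (C : Circuit s n k)

/-- The circuit area: the number of unit squares that hold a node or a part of a wire. -/
noncomputable def area : ℕ :=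
  (C.nodes ∪ Finset.univ.biUnion fun w => (C.route w).support.toFinset).card

/-- The energy of the computation, the product of the area and the number of clock cycles. -/
noncomputable def energy : ℕ := C.area * C.cycles

/-- The input symbol (if any) that node `v` receives in clock cycle `t`, on input `y`. -/
def inputSymbol (y : Fin n → Symbol) (t : ℕ) (v : C.nodes) : Option Symbol :=
  (C.inputAt v t).map y

/-- The node at the other end of a wire `w` that ends at `v`. -/
def farEnd (v : C.nodes) (w : Fin C.numWires) : C.nodes :=
  if C.tail w = v then C.head w else C.tail w

/-- The bits that node `v` receives in clock cycle `t` when the memories hold `m`. -/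
def received (y : Fin n → Symbol) (t : ℕ) (m : C.nodes → Fin s → Bool) (v : C.nodes)
    (w : {w : Fin C.numWires // C.tail w = v ∨ C.head w = v}) : Bool :=
  C.send (C.farEnd v w) t (m (C.farEnd v w)) (C.inputSymbol y t (C.farEnd v w)) w

/-- The contents of the memories at the beginning of clock cycle `t`, on input `y`. -/
def memory (y : Fin n → Symbol) : ℕ → C.nodes → Fin s → Bool
  | 0 => C.init
  | t + 1 => fun v => C.update v t (memory y t v) (C.inputSymbol y t v)
      (C.received y t (memory y t) v)

/-- The function computed by the circuit. -/
def decode (y : Fin n → Symbol) (i : Fin k) : Bool :=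
  let v := (C.outputAt i).1
  let t := (C.outputAt i).2
  C.emit v t (C.memory y t v) (C.inputSymbol y t v) (C.received y t (C.memory y t) v)

/-- The output nodes of the circuit. -/
def outputNodes : Finset C.nodes := Finset.univ.image fun i => (C.outputAt i).1

/-- In every clock cycle in which some output node produces a bit, all of them do. -/
def OutputRegular : Prop :=
  ∀ v ∈ C.outputNodes, ∀ i, ∃ i', C.outputAt i' = (v, (C.outputAt i).2)

end Circuit

/-- The transition probabilities of the binary erasure channel with erasure probability `ε`. -/
def bec (ε : ℝ) (x : Bool) (y : Symbol) : ℝ :=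
  if y = none then ε else if y = some x then 1 - ε else 0

/-- The block error probability of a decoding circuit for the code with encoding function `enc`:
the source is `k` independent fair bits, and the codeword is sent over `n` uses of the binary
erasure channel. -/
noncomputable def blockErrorProb {s n k : ℕ} (ε : ℝ) (enc : (Fin k → Bool) → (Fin n → Bool))
    (C : Circuit s n k) : ℝ :=
  ∑ x : Fin k → Bool, (1 / 2 : ℝ) ^ k *
    ∑ y : Fin n → Symbol, if C.decode y = x then 0 else ∏ i, bec ε (enc x i) (y i)

/-- A decoding scheme: a sequence of codes of increasing block length with decoding circuits.
All nodes of all the circuits have `s` bits of memory. -/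
structure DecodingScheme (s : ℕ) where
  /-- The block lengths. -/
  n : ℕ → ℕ
  n_strictMono : StrictMono n
  /-- The numbers of bits decoded. -/
  k : ℕ → ℕ
  /-- The encoding functions of the codes. -/
  enc : ∀ i, (Fin (k i) → Bool) → (Fin (n i) → Bool)
  circuit : ∀ i, Circuit s (n i) (k i)

namespace DecodingScheme

variable {s : ℕ} (D : DecodingScheme s)

/-- `R` is the asymptotic rate of the scheme. -/
def HasRate (R : ℝ) : Prop :=
  Tendsto (fun i => (D.k i : ℝ) / (D.n i : ℝ)) atTop (𝓝 R)

/-- The scheme is an `f(n)`-decoding scheme for the binary erasure channel with erasure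
probability `ε`. -/
def IsErrorScheme (ε : ℝ) (f : ℕ → ℝ) : Prop :=
  ∀ᶠ i in atTop, blockErrorProb ε (D.enc i) (D.circuit i) < f (D.n i)

def OutputRegular : Prop := ∀ i, (D.circuit i).OutputRegular

/-- The number of output nodes increases (without bound) with the block length. -/
def IncreasingOutputNodes : Prop :=
  Tendsto (fun i => (D.circuit i).outputNodes.card) atTop atTop

end DecodingScheme

end VLSI

/-!
Cut space-time into pieces: `d × d` boxes of the grid times intervals of `d` clock cycles. The bits
that enter a piece are the memory contents of its nodes at the beginning of its interval and the
bits that arrive along the wires that cross the boundary of its box. For a suitable offset of the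
boxes these are at most `(s + 4) * energy / d` bits in total, as wires have to cross distinct sides
of squares. If this is less than `k`, then some piece produces more output bits than enter it. When
the at most `d ^ 3` input symbols of that piece are all erased, its output bits take at most half of
their possible values, so the decoder errs with probability at least `ε ^ d ^ 3 / 2`. Taking
`d` of the order of `energy / k` bounds `-log f(n)` by a multiple of `(energy / n) ^ 3`, which gives
the exponent `1 / 3`; smaller exponents follow since the energy is at least `n`.
-/

namespace VLSI

open Finset

section Erasures

lemma bec_nonneg {ε : ℝ} (h0 : 0 ≤ ε) (h1 : ε ≤ 1) (x : Bool) (y : Symbol) : 0 ≤ bec ε x y := by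
  unfold bec
  split_ifs <;> linarith

lemma sum_bec (ε : ℝ) (x : Bool) : ∑ y : Symbol, bec ε x y = 1 := by
  cases x <;> simp [bec, Fintype.sum_option]

variable {ι : Type*} [Fintype ι] [DecidableEq ι]

/-- The event that all channel outputs with index in `J` are erased. -/
def erasedOn (J : Finset ι) : Finset (ι → Symbol) :=
  Fintype.piFinset fun i => if i ∈ J then {none} else univ

lemma mem_erasedOn {J : Finset ι} {y : ι → Symbol} : y ∈ erasedOn J ↔ ∀ i ∈ J, y i = none := by
  simp only [erasedOn, Fintype.mem_piFinset]
  refine forall_congr' fun i => ?_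
  by_cases hi : i ∈ J <;> simp [hi]

lemma sum_erasedOn_prod_bec (ε : ℝ) (x : ι → Bool) (J : Finset ι) :
    ∑ y ∈ erasedOn J, ∏ i, bec ε (x i) (y i) = ε ^ #J := by
  have hfactor : ∀ i, ∑ b ∈ (if i ∈ J then {none} else univ : Finset Symbol), bec ε (x i) b =
      if i ∈ J then ε else 1 := fun i => by
    split_ifs
    · simp [bec]
    · exact sum_bec ε (x i)
  rw [erasedOn, ← prod_univ_sum]
  simp only [hfactor, prod_ite_mem, univ_inter, prod_const]

lemma pow_card_le_sum_prod_bec_of_notMem_image {X : Type*} [DecidableEq X] {ε : ℝ} (h0 : 0 ≤ ε)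
    (h1 : ε ≤ 1) (dec : (ι → Symbol) → X) (x : X) (c : ι → Bool) (J : Finset ι)
    (hx : x ∉ (erasedOn J).image dec) :
    ε ^ #J ≤ ∑ y : ι → Symbol, if dec y = x then 0 else ∏ i, bec ε (c i) (y i) := by
  have hprod (y : ι → Symbol) : 0 ≤ ∏ i, bec ε (c i) (y i) :=
    prod_nonneg fun i _ => bec_nonneg h0 h1 _ _
  calc ε ^ #J = ∑ y ∈ erasedOn J, if dec y = x then 0 else ∏ i, bec ε (c i) (y i) := by
        rw [← sum_erasedOn_prod_bec ε c J]
        refine sum_congr rfl fun y hy => (if_neg ?_).symm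
        rintro rfl
        exact hx (mem_image_of_mem dec hy)
    _ ≤ _ := sum_le_univ_sum_of_nonneg fun y => by
        split_ifs
        exacts [le_rfl, hprod y]

lemma pow_card_mul_le_blockErrorProb {s n k : ℕ} {ε : ℝ} (h0 : 0 ≤ ε) (h1 : ε ≤ 1)
    (enc : (Fin k → Bool) → (Fin n → Bool)) (C : Circuit s n k) (J : Finset (Fin n)) :
    ε ^ #J * (1 - #((erasedOn J).image C.decode) / 2 ^ k) ≤ blockErrorProb ε enc C := by
  set G := (erasedOn J).image C.decode
  have hG : (#Gᶜ : ℝ) = 2 ^ k - #G := by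
    rw [card_compl, Nat.cast_sub (card_le_univ G)]
    simp
  calc ε ^ #J * (1 - #G / 2 ^ k) = ∑ _x ∈ Gᶜ, (1 / 2 : ℝ) ^ k * ε ^ #J := by
        rw [sum_const, nsmul_eq_mul, hG, one_div, inv_pow]
        field_simp
    _ ≤ ∑ x ∈ Gᶜ, (1 / 2 : ℝ) ^ k *
          ∑ y : Fin n → Symbol, if C.decode y = x then 0 else ∏ i, bec ε (enc x i) (y i) := by
        gcongr with _ hx
        exact pow_card_le_sum_prod_bec_of_notMem_image h0 h1 _ _ _ _ (mem_compl.1 hx)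
    _ ≤ blockErrorProb ε enc C := by
        refine sum_le_univ_sum_of_nonneg fun x => mul_nonneg (by positivity) ?_
        refine sum_nonneg fun y _ => ?_
        split_ifs
        exacts [le_rfl, prod_nonneg fun i _ => bec_nonneg h0 h1 _ _]

lemma two_mul_card_image_le_of_determined {Y U K : Type*} [Fintype U] [Fintype K]
    (F : Finset Y) (dec : Y → K → Bool) (tr : Y → U → Bool) (O : Finset K)
    (hUO : Fintype.card U < #O)
    (hdet : ∀ y ∈ F, ∀ y' ∈ F, tr y = tr y' → Set.EqOn (dec y) (dec y') O) :
    2 * #(F.image dec) ≤ 2 ^ Fintype.card K := by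
  classical
  have hinj : #(F.image dec) ≤ #(univ : Finset ((U → Bool) × ({i // i ∉ O} → Bool))) := by
    refine card_le_card_of_forall_subsingleton
      (fun x c => ∃ y ∈ F, dec y = x ∧ tr y = c.1 ∧ (fun i : {i // i ∉ O} => x i) = c.2)
      (fun x hx => ?_) fun c _ => ?_
    · obtain ⟨y, hy, hyx⟩ := mem_image.1 hx
      exact ⟨(tr y, fun i => x i), mem_univ _, y, hy, hyx, rfl, rfl⟩
    · rintro _ ⟨-, y, hy, rfl, htr, hrest⟩ _ ⟨-, y', hy', rfl, htr', hrest'⟩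
      funext i
      by_cases hi : i ∈ O
      · exact hdet y hy y' hy' (htr.trans htr'.symm) hi
      · exact congrFun (hrest.trans hrest'.symm) ⟨i, hi⟩
  have hO : #O ≤ Fintype.card K := card_le_univ O
  calc 2 * #(F.image dec) ≤ 2 * 2 ^ (Fintype.card U + (Fintype.card K - #O)) := by
        refine Nat.mul_le_mul_left _ (hinj.trans_eq ?_)
        rw [card_univ, Fintype.card_prod, Fintype.card_fun, Fintype.card_fun, Fintype.card_bool,
          Fintype.card_subtype_compl, Fintype.card_coe, pow_add]
    _ = 2 ^ (Fintype.card U + (Fintype.card K - #O) + 1) := by ring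
    _ ≤ 2 ^ Fintype.card K := Nat.pow_le_pow_right two_pos (by lia)

lemma pow_card_div_two_le_blockErrorProb_of_determined {s n k : ℕ} {U : Type*} [Fintype U] {ε : ℝ}
    (h0 : 0 ≤ ε) (h1 : ε ≤ 1) (enc : (Fin k → Bool) → (Fin n → Bool)) (C : Circuit s n k)
    (J : Finset (Fin n)) (tr : (Fin n → Symbol) → U → Bool) (O : Finset (Fin k))
    (hUO : Fintype.card U < #O)
    (hdet : ∀ y ∈ erasedOn J, ∀ y' ∈ erasedOn J, tr y = tr y' →
      Set.EqOn (C.decode y) (C.decode y') O) :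
    ε ^ #J / 2 ≤ blockErrorProb ε enc C := by
  have hcard := two_mul_card_image_le_of_determined (erasedOn J) C.decode tr O hUO hdet
  rw [Fintype.card_fin] at hcard
  have hhalf : (#((erasedOn J).image C.decode) : ℝ) / 2 ^ k ≤ 1 / 2 := by
    rw [div_le_div_iff₀ (by positivity) two_pos, mul_comm, one_mul]
    exact_mod_cast hcard
  calc ε ^ #J / 2 = ε ^ #J * (1 - 1 / 2) := by ring
    _ ≤ ε ^ #J * (1 - #((erasedOn J).image C.decode) / 2 ^ k) := by gcongr
    _ ≤ blockErrorProb ε enc C := pow_card_mul_le_blockErrorProb h0 h1 enc C J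

end Erasures

namespace Circuit

section Pieces

variable {s n k : ℕ} (C : Circuit s n k)

/-- The inputs of a piece of space-time: those that enter at a node of `S` in a clock cycle of
`[t₀, t₁)`. -/
def inputsIn (S : Finset C.nodes) (t₀ t₁ : ℕ) : Finset (Fin n) :=
  (S ×ˢ Ico t₀ t₁).biUnion fun p => (C.inputAt p.1 p.2).toFinset

/-- The outputs of a piece of space-time: those produced at a node of `S` in a clock cycle of
`[t₀, t₁)`. -/
def outputsIn (S : Finset C.nodes) (t₀ t₁ : ℕ) : Finset (Fin k) :=
  {i | C.outputAt i ∈ S ×ˢ Ico t₀ t₁}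

/-- The wires that lead out of a set of nodes: those with exactly one end in `S`. -/
def cutWires (S : Finset C.nodes) : Finset (Fin C.numWires) :=
  {w | ¬(C.tail w ∈ S ↔ C.head w ∈ S)}

/-- The end outside `S` of a wire in `C.cutWires S` (for other wires the value is irrelevant). -/
def outerEnd (S : Finset C.nodes) (w : Fin C.numWires) : C.nodes :=
  if C.tail w ∈ S then C.head w else C.tail w

/-- The bits that enter the piece `S × [t₀, t₁)` of space-time: the memory contents at the beginning
of cycle `t₀`, and the bits that arrive along the cut wires. The memory contents are left out when
`t₀ = 0`, as they do not depend on the input then. -/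
def boundaryBits (S : Finset C.nodes) (t₀ t₁ : ℕ) :
    Finset ((C.nodes × Fin s) ⊕ (Fin C.numWires × ℕ)) :=
  (if t₀ = 0 then ∅ else S ×ˢ univ).disjSum (C.cutWires S ×ˢ Ico t₀ t₁)

/-- The values, on input `y`, of the bits that enter a piece that begins in cycle `t₀`. -/
def boundaryValue (S : Finset C.nodes) (t₀ : ℕ) (y : Fin n → Symbol) :
    (C.nodes × Fin s) ⊕ (Fin C.numWires × ℕ) → Bool
  | .inl (v, j) => C.memory y t₀ v j
  | .inr (w, t) => C.send (C.outerEnd S w) t (C.memory y t (C.outerEnd S w))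
      (C.inputSymbol y t (C.outerEnd S w)) w

lemma card_inputsIn_le (S : Finset C.nodes) (t₀ t₁ : ℕ) :
    #(C.inputsIn S t₀ t₁) ≤ #S * (t₁ - t₀) := by
  have hone (p : C.nodes × ℕ) : #(C.inputAt p.1 p.2).toFinset ≤ 1 := by
    cases C.inputAt p.1 p.2 <;> simp
  simpa only [inputsIn, card_product, Nat.card_Ico, mul_one] using
    card_biUnion_le_card_mul (S ×ˢ Ico t₀ t₁) _ 1 fun p _ => hone p

lemma card_boundaryBits (S : Finset C.nodes) (t₀ t₁ : ℕ) :
    #(C.boundaryBits S t₀ t₁) = (if t₀ = 0 then 0 else #S * s) + #(C.cutWires S) * (t₁ - t₀) := by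
  rw [boundaryBits, card_disjSum, card_product, Nat.card_Ico, apply_ite card, card_empty,
    card_product, card_univ, Fintype.card_fin]

variable {C}

lemma farEnd_eq_outerEnd {S : Finset C.nodes} {v : C.nodes} (hv : v ∈ S) {w : Fin C.numWires}
    (hw : C.tail w = v ∨ C.head w = v) (hfar : C.farEnd v w ∉ S) :
    w ∈ C.cutWires S ∧ C.farEnd v w = C.outerEnd S w := by
  simp only [farEnd, outerEnd, cutWires, mem_filter, mem_univ, true_and] at hfar ⊢
  grind

variable {S : Finset C.nodes} {t₀ t₁ t : ℕ} {y y' : Fin n → Symbol}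

lemma inputSymbol_eq_of_eqOn (hin : Set.EqOn y y' (C.inputsIn S t₀ t₁)) (ht : t ∈ Ico t₀ t₁)
    {v : C.nodes} (hv : v ∈ S) : C.inputSymbol y t v = C.inputSymbol y' t v :=
  Option.map_congr fun _ hi =>
    hin (mem_biUnion.2 ⟨(v, t), mem_product.2 ⟨hv, ht⟩, Option.mem_toFinset.2 hi⟩)

lemma received_eq_of_eqOn (hin : Set.EqOn y y' (C.inputsIn S t₀ t₁))
    (hval : Set.EqOn (C.boundaryValue S t₀ y) (C.boundaryValue S t₀ y') (C.boundaryBits S t₀ t₁))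
    (ht : t ∈ Ico t₀ t₁) (hmem : Set.EqOn (C.memory y t) (C.memory y' t) S)
    {v : C.nodes} (hv : v ∈ S) :
    C.received y t (C.memory y t) v = C.received y' t (C.memory y' t) v := by
  funext ⟨w, hw⟩
  unfold received
  by_cases hfar : C.farEnd v w ∈ S
  · rw [hmem hfar, inputSymbol_eq_of_eqOn hin ht hfar]
  · obtain ⟨hcut, hend⟩ := farEnd_eq_outerEnd hv hw hfar
    simp only [hend]
    exact hval (inr_mem_disjSum.2 (mem_product.2 ⟨hcut, ht⟩) : .inr (w, t) ∈ _)

lemma memory_eqOn_of_eqOn (hin : Set.EqOn y y' (C.inputsIn S t₀ t₁))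
    (hval : Set.EqOn (C.boundaryValue S t₀ y) (C.boundaryValue S t₀ y') (C.boundaryBits S t₀ t₁))
    (h₀ : t₀ ≤ t) (h₁ : t ≤ t₁) : Set.EqOn (C.memory y t) (C.memory y' t) S := by
  induction t, h₀ using Nat.le_induction with
  | base =>
    intro v hv
    rcases eq_or_ne t₀ 0 with rfl | h0
    · rfl
    · funext j
      refine hval (x := .inl (v, j)) ?_
      simpa [boundaryBits, h0] using hv
  | succ t ht ih =>
    intro v hv
    have htm : t ∈ Ico t₀ t₁ := mem_Ico.2 ⟨ht, h₁⟩
    have hmem := ih (Nat.le_of_succ_le h₁)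
    simp only [memory]
    rw [hmem hv, inputSymbol_eq_of_eqOn hin htm hv, received_eq_of_eqOn hin hval htm hmem hv]

lemma decode_eqOn_of_eqOn (hin : Set.EqOn y y' (C.inputsIn S t₀ t₁))
    (hval : Set.EqOn (C.boundaryValue S t₀ y) (C.boundaryValue S t₀ y') (C.boundaryBits S t₀ t₁)) :
    Set.EqOn (C.decode y) (C.decode y') (C.outputsIn S t₀ t₁) := by
  intro i hi
  obtain ⟨hv, ht⟩ := mem_product.1 (mem_filter.1 hi).2
  have hmem := memory_eqOn_of_eqOn hin hval (mem_Ico.1 ht).1 (mem_Ico.1 ht).2.le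
  simp only [decode]
  rw [hmem hv, inputSymbol_eq_of_eqOn hin ht hv, received_eq_of_eqOn hin hval ht hmem hv]

lemma pow_card_inputsIn_div_two_le_blockErrorProb {ε : ℝ} (h0 : 0 ≤ ε) (h1 : ε ≤ 1)
    (enc : (Fin k → Bool) → (Fin n → Bool))
    (h : #(C.boundaryBits S t₀ t₁) < #(C.outputsIn S t₀ t₁)) :
    ε ^ #(C.inputsIn S t₀ t₁) / 2 ≤ blockErrorProb ε enc C := by
  refine pow_card_div_two_le_blockErrorProb_of_determined h0 h1 enc C _
    (fun y (b : C.boundaryBits S t₀ t₁) => C.boundaryValue S t₀ y b) _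
    (by rwa [Fintype.card_coe]) fun y hy y' hy' htr => decode_eqOn_of_eqOn ?_ ?_
  · exact fun i hi => (mem_erasedOn.1 hy i hi).trans (mem_erasedOn.1 hy' i hi).symm
  · exact fun b hb => congrFun htr ⟨b, hb⟩

end Pieces

section Partition

variable {s n k : ℕ} (C : Circuit s n k)

lemma card_nodes_le_area : #C.nodes ≤ C.area := card_le_card subset_union_left

lemma inputs_le_energy : n ≤ C.energy := by
  have hall : C.inputsIn univ 0 C.cycles = univ := by
    refine eq_univ_of_forall fun i => ?_
    obtain ⟨⟨v, t⟩, h, -⟩ := C.inputAt_once i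
    exact mem_biUnion.2 ⟨(v, t), by simpa using C.inputAt_lt v t i h, Option.mem_toFinset.2 h⟩
  calc n = #(C.inputsIn univ 0 C.cycles) := by rw [hall, card_univ, Fintype.card_fin]
    _ ≤ #C.nodes * C.cycles := by simpa using C.card_inputsIn_le univ 0 C.cycles
    _ ≤ C.energy := Nat.mul_le_mul_right _ C.card_nodes_le_area

variable {X : Type*} [DecidableEq X] (κ : C.nodes → X)

/-- The part with label `p` in the partition of the nodes by the labelling `κ`. -/
def block (p : X) : Finset C.nodes := {v | κ v = p}

/-- The wires between different parts of the partition of the nodes by the labelling `κ`. -/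
def crossWires : Finset (Fin C.numWires) := {w | κ (C.tail w) ≠ κ (C.head w)}

lemma sum_card_block : ∑ p ∈ univ.image κ, #(C.block κ p) = #C.nodes := by
  rw [← Fintype.card_coe, ← card_univ]
  exact (card_eq_sum_card_image κ _).symm

lemma sum_card_cutWires_le :
    ∑ p ∈ univ.image κ, #(C.cutWires (C.block κ p)) ≤ 2 * #(C.crossWires κ) := by
  have hfiber (e : Fin C.numWires → C.nodes) :
      ∑ p ∈ univ.image κ, #{w ∈ C.crossWires κ | κ (e w) = p} = #(C.crossWires κ) :=
    (card_eq_sum_card_fiberwise fun _ _ => mem_image_of_mem _ (mem_univ _)).symm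
  calc ∑ p ∈ univ.image κ, #(C.cutWires (C.block κ p))
      ≤ ∑ p ∈ univ.image κ, (#{w ∈ C.crossWires κ | κ (C.tail w) = p} +
          #{w ∈ C.crossWires κ | κ (C.head w) = p}) := by
        refine sum_le_sum fun p _ => (card_le_card fun w hw => ?_).trans (card_union_le _ _)
        simp only [cutWires, crossWires, block, mem_filter, mem_univ, true_and, mem_union] at hw ⊢
        grind
    _ = 2 * #(C.crossWires κ) := by rw [sum_add_distrib, hfiber, hfiber, two_mul]

lemma sum_card_boundaryBits_le (S : Finset C.nodes) {τ : ℕ → ℕ} (hτ : Monotone τ) (hτ0 : τ 0 = 0)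
    (M : ℕ) :
    ∑ m ∈ range (M + 1), #(C.boundaryBits S (τ m) (τ (m + 1))) ≤
      M * (#S * s) + #(C.cutWires S) * τ (M + 1) := by
  simp only [card_boundaryBits, sum_add_distrib, ← mul_sum, sum_range_tsub hτ, hτ0, tsub_zero]
  refine Nat.add_le_add_right ?_ _
  rw [sum_range_succ', if_pos hτ0, add_zero]
  refine (sum_le_card_nsmul _ _ (#S * s) fun m _ => ?_).trans_eq ?_
  · split_ifs
    exacts [Nat.zero_le _, le_rfl]
  · rw [card_range, smul_eq_mul]

lemma outputs_le_sum_card_outputsIn {τ : ℕ → ℕ} (hτ0 : τ 0 = 0) {M : ℕ}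
    (hM : C.cycles ≤ τ (M + 1)) :
    k ≤ ∑ p ∈ univ.image κ, ∑ m ∈ range (M + 1),
      #(C.outputsIn (C.block κ p) (τ m) (τ (m + 1))) := by
  have hcover : ∀ N t, t < τ N → ∃ m < N, t ∈ Ico (τ m) (τ (m + 1)) := by
    intro N t
    induction N with
    | zero => simp [hτ0]
    | succ N ih => grind
  rw [← sum_product']
  refine (card_fin k).symm.trans_le ((card_le_card fun i _ => ?_).trans card_biUnion_le)
  obtain ⟨m, hm, ht⟩ := hcover (M + 1) _ ((C.outputAt_lt i).trans_le hM)
  exact mem_biUnion.2 ⟨(κ (C.outputAt i).1, m),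
    mem_product.2 ⟨mem_image_of_mem _ (mem_univ _), mem_range.2 hm⟩,
    by simpa [outputsIn, block] using ht⟩

lemma outputs_le_of_forall_card_outputsIn_le {τ : ℕ → ℕ} (hτ : Monotone τ) (hτ0 : τ 0 = 0) {M : ℕ}
    (hM : C.cycles ≤ τ (M + 1))
    (h : ∀ p m, #(C.outputsIn (C.block κ p) (τ m) (τ (m + 1))) ≤
      #(C.boundaryBits (C.block κ p) (τ m) (τ (m + 1)))) :
    k ≤ M * (#C.nodes * s) + 2 * #(C.crossWires κ) * τ (M + 1) := by
  calc k ≤ _ := C.outputs_le_sum_card_outputsIn κ hτ0 hM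
    _ ≤ ∑ p ∈ univ.image κ, (M * (#(C.block κ p) * s) + #(C.cutWires (C.block κ p)) * τ (M + 1)) :=
        sum_le_sum fun p _ => (sum_le_sum fun m _ => h p m).trans
          (C.sum_card_boundaryBits_le (C.block κ p) hτ hτ0 M)
    _ = M * (#C.nodes * s) + (∑ p ∈ univ.image κ, #(C.cutWires (C.block κ p))) * τ (M + 1) := by
        rw [sum_add_distrib, ← mul_sum, ← sum_mul, ← sum_mul, sum_card_block]
    _ ≤ _ := by gcongr; exact C.sum_card_cutWires_le κ

end Partition

end Circuit

section Strips

lemma dvd_of_sub_one_ediv_ne {d a : ℤ} (hd : 0 < d) (h : (a - 1) / d ≠ a / d) : d ∣ a := by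
  contrapose! h
  have hmod : 0 < a % d :=
    (Int.emod_nonneg a hd.ne').lt_of_ne fun h0 => h (Int.dvd_of_emod_eq_zero h0.symm)
  have hmod_lt := Int.emod_lt_of_pos a hd
  have hdecomp := Int.mul_ediv_add_emod a d
  rw [Int.ediv_eq_iff_of_pos hd]
  constructor <;> nlinarith

lemma exists_mul_card_modEq_le {α : Type*} (F : Finset α) (c : α → ℤ) {d : ℕ} (hd : 0 < d) :
    ∃ r : ℤ, d * #{a ∈ F | c a ≡ r [ZMOD d]} ≤ #F := by
  have hd' : (0 : ℤ) < d := by exact_mod_cast hd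
  have hresidue : Set.MapsTo (fun a => c a % d) F (Ico (0 : ℤ) d) := fun a _ =>
    mem_coe.2 (mem_Ico.2 ⟨Int.emod_nonneg _ hd'.ne', Int.emod_lt_of_pos _ hd'⟩)
  have hsum : ∑ r ∈ Ico (0 : ℤ) d, d * #{a ∈ F | c a % d = r} ≤ ∑ _r ∈ Ico (0 : ℤ) d, #F := by
    rw [← mul_sum, ← card_eq_sum_card_fiberwise hresidue, sum_const, Int.card_Ico]
    simp
  obtain ⟨r, hr, hle⟩ := exists_le_of_sum_le (nonempty_Ico.2 hd') hsum
  obtain ⟨hr0, hrd⟩ := mem_Ico.1 hr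
  refine ⟨r, ?_⟩
  simpa only [Int.ModEq, Int.emod_eq_of_lt hr0 hrd] using hle

/-- `c` is a coordinate of the grid with unit vector `e`: it changes only in steps by `e`, and then
by one. It lets the two directions be treated alike. -/
def IsGridCoordinate (c : ℤ × ℤ → ℤ) (e : ℤ × ℤ) : Prop :=
  ∀ ⦃x y⦄, grid.Adj x y → c x = c y ∨ (y = x + e ∧ c y = c x + 1) ∨ (x = y + e ∧ c x = c y + 1)

lemma isGridCoordinate_fst : IsGridCoordinate Prod.fst (1, 0) := by
  intro x y h
  simp only [SimpleGraph.boxProd_adj, SimpleGraph.hasse_adj, ← Order.succ_eq_iff_covBy,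
    Order.succ_eq_add_one] at h
  simp only [Prod.ext_iff, Prod.fst_add, Prod.snd_add]
  grind

lemma isGridCoordinate_snd : IsGridCoordinate Prod.snd (0, 1) := by
  intro x y h
  simp only [SimpleGraph.boxProd_adj, SimpleGraph.hasse_adj, ← Order.succ_eq_iff_covBy,
    Order.succ_eq_add_one] at h
  simp only [Prod.ext_iff, Prod.fst_add, Prod.snd_add]
  grind

/-- The index of the strip that holds `x`, when the grid is cut into strips of width `d` across the
coordinate `c`, beginning at the values of `c` congruent to `r`. -/
def strip (c : ℤ × ℤ → ℤ) (d : ℕ) (r : ℤ) (x : ℤ × ℤ) : ℤ := (c x - r) / d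

variable {c : ℤ × ℤ → ℤ} {e : ℤ × ℤ} {d : ℕ} {r : ℤ}

lemma IsGridCoordinate.exists_mem_edges_of_strip_ne (hc : IsGridCoordinate c e) (hd : 0 < d)
    {u v : ℤ × ℤ} (p : grid.Walk u v) (h : strip c d r u ≠ strip c d r v) :
    ∃ x ∈ p.support, c x ≡ r [ZMOD d] ∧ s(x - e, x) ∈ p.edges := by
  have hstep {x y : ℤ × ℤ} (hxy : c y = c x + 1) (hne : strip c d r x ≠ strip c d r y) :
      c y ≡ r [ZMOD d] := by
    refine (Int.modEq_of_dvd (dvd_of_sub_one_ediv_ne (by exact_mod_cast hd) ?_)).symm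
    rwa [strip, strip, show c x - r = c y - r - 1 by lia] at hne
  obtain ⟨a, ha, hfst, hsnd⟩ :=
    p.exists_boundary_dart {x | strip c d r x = strip c d r u} rfl (Ne.symm h)
  have hne : strip c d r a.fst ≠ strip c d r a.snd := fun heq => hsnd (heq.symm.trans hfst)
  have hedge : s(a.fst, a.snd) ∈ p.edges := List.mem_map_of_mem ha
  rcases hc a.adj with heq | ⟨hadd, hone⟩ | ⟨hadd, hone⟩
  · exact absurd (by rw [strip, strip, heq]) hne
  · refine ⟨a.snd, p.dart_snd_mem_support_of_mem_darts ha, hstep hone hne, ?_⟩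
    rwa [hadd, add_sub_cancel_right, ← hadd]
  · refine ⟨a.fst, p.dart_fst_mem_support_of_mem_darts ha, hstep hone hne.symm, ?_⟩
    rwa [hadd, add_sub_cancel_right, ← hadd, Sym2.eq_swap]

namespace Circuit

variable {s n k : ℕ} (C : Circuit s n k)

/-- The squares that hold a node or a part of a wire; `C.area` is their number. -/
noncomputable def occupied : Finset (ℤ × ℤ) :=
  C.nodes ∪ univ.biUnion fun w => (C.route w).support.toFinset

lemma card_crossWires_strip_le (hc : IsGridCoordinate c e) (hd : 0 < d) (r : ℤ) :
    #(C.crossWires fun v => strip c d r v) ≤ #{x ∈ C.occupied | c x ≡ r [ZMOD d]} := by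
  refine card_le_card_of_forall_subsingleton (fun w x => s(x - e, x) ∈ (C.route w).edges)
    (fun w hw => ?_) fun x _ w hw w' hw' => ?_
  · obtain ⟨x, hx, hmod, hedge⟩ :=
      hc.exists_mem_edges_of_strip_ne hd (C.route w) (mem_filter.1 hw).2
    have hocc : x ∈ C.occupied :=
      mem_union_right _ (mem_biUnion.2 ⟨w, mem_univ _, List.mem_toFinset.2 hx⟩)
    exact ⟨x, mem_filter.2 ⟨hocc, hmod⟩, hedge⟩
  · by_contra hne
    exact C.route_disjoint w w' hne hw.2 hw'.2

lemma exists_mul_card_crossWires_strip_le (hc : IsGridCoordinate c e) (hd : 0 < d) :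
    ∃ r : ℤ, d * #(C.crossWires fun v => strip c d r v) ≤ C.area := by
  obtain ⟨r, hr⟩ := exists_mul_card_modEq_le C.occupied c hd
  exact ⟨r, (Nat.mul_le_mul_left d (C.card_crossWires_strip_le hc hd r)).trans hr⟩

lemma card_crossWires_prod_le {X Y : Type*} [DecidableEq X] [DecidableEq Y] (κ : C.nodes → X)
    (κ' : C.nodes → Y) :
    #(C.crossWires fun v => (κ v, κ' v)) ≤ #(C.crossWires κ) + #(C.crossWires κ') := by
  refine (card_le_card fun w hw => ?_).trans (card_union_le _ _)
  simpa only [crossWires, mem_filter, mem_univ, true_and, mem_union, ne_eq, Prod.mk.injEq,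
    not_and_or] using hw

lemma card_block_box_le (hd : 0 < d) (r₁ r₂ : ℤ) (p : ℤ × ℤ) :
    #(C.block (fun v => (strip Prod.fst d r₁ v, strip Prod.snd d r₂ v)) p) ≤ d ^ 2 := by
  have hd' : (0 : ℤ) < d := by exact_mod_cast hd
  calc _ ≤ #(Ico (p.1 * d + r₁) (p.1 * d + r₁ + d) ×ˢ Ico (p.2 * d + r₂) (p.2 * d + r₂ + d)) := by
        refine card_le_card_of_injOn Subtype.val (fun v hv => ?_) Subtype.val_injective.injOn
        have hbox := (mem_filter.1 hv).2
        simp only [strip, Prod.ext_iff, Int.ediv_eq_iff_of_pos hd'] at hbox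
        simp only [coe_product, Set.mem_prod, mem_coe, mem_Ico]
        constructor <;> constructor <;> linarith
    _ = d ^ 2 := by simp [card_product, sq]

lemma exists_card_block_le_and_mul_card_crossWires_le (hd : 0 < d) :
    ∃ κ : C.nodes → ℤ × ℤ, (∀ p, #(C.block κ p) ≤ d ^ 2) ∧ d * #(C.crossWires κ) ≤ 2 * C.area := by
  obtain ⟨r₁, h₁⟩ := C.exists_mul_card_crossWires_strip_le isGridCoordinate_fst hd
  obtain ⟨r₂, h₂⟩ := C.exists_mul_card_crossWires_strip_le isGridCoordinate_snd hd
  refine ⟨fun v => (strip Prod.fst d r₁ v, strip Prod.snd d r₂ v), C.card_block_box_le hd r₁ r₂, ?_⟩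
  calc _ ≤ d * (_ + _) := Nat.mul_le_mul_left d (C.card_crossWires_prod_le _ _)
    _ ≤ 2 * C.area := by rw [mul_add, two_mul]; exact add_le_add h₁ h₂

end Circuit

end Strips

namespace Circuit

variable {s n k : ℕ} (C : Circuit s n k)

lemma exists_card_boundaryBits_lt_card_outputsIn {d : ℕ} (h : (s + 4) * C.energy < d * k) :
    ∃ S t₀ t₁, #S ≤ d ^ 2 ∧ t₁ - t₀ ≤ d ∧ #(C.boundaryBits S t₀ t₁) < #(C.outputsIn S t₀ t₁) := by
  have hd : 0 < d := Nat.pos_of_mul_pos_right (Nat.zero_le _ |>.trans_lt h)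
  obtain ⟨κ, hblock, hcross⟩ := C.exists_card_block_le_and_mul_card_crossWires_le hd
  by_contra! hpieces
  set T := C.cycles
  set τ : ℕ → ℕ := fun m => min (m * d) T with hτ
  have hmono : Monotone τ := fun a b hab => by simp only [hτ]; gcongr
  have hlast : τ (T / d + 1) = T := min_eq_right (Nat.lt_div_mul_add hd |>.le.trans_eq (by ring))
  have hlength (m : ℕ) : τ (m + 1) - τ m ≤ d := by simp only [hτ, add_one_mul]; lia
  have hk := C.outputs_le_of_forall_card_outputsIn_le κ hmono (by simp [hτ]) hlast.ge
    fun p m => hpieces _ _ _ (hblock p) (hlength m)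
  rw [hlast] at hk
  refine h.not_ge ?_
  calc d * k ≤ d * (T / d * (#C.nodes * s) + 2 * #(C.crossWires κ) * T) := by gcongr
    _ = T / d * d * (#C.nodes * s) + 2 * (d * #(C.crossWires κ)) * T := by ring
    _ ≤ T * (C.area * s) + 2 * (2 * C.area) * T := by
        gcongr
        exacts [Nat.div_mul_le_self T d, C.card_nodes_le_area]
    _ = (s + 4) * C.energy := by rw [energy]; ring

lemma pow_div_two_le_blockErrorProb_of_energy_lt {ε : ℝ} (h0 : 0 ≤ ε) (h1 : ε ≤ 1)
    (enc : (Fin k → Bool) → (Fin n → Bool)) {d : ℕ} (h : (s + 4) * C.energy < d * k) :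
    ε ^ d ^ 3 / 2 ≤ blockErrorProb ε enc C := by
  obtain ⟨S, t₀, t₁, hS, hlength, hpiece⟩ := C.exists_card_boundaryBits_lt_card_outputsIn h
  have hinputs : #(C.inputsIn S t₀ t₁) ≤ d ^ 3 :=
    (C.card_inputsIn_le S t₀ t₁).trans (Nat.mul_le_mul hS hlength)
  calc ε ^ d ^ 3 / 2 ≤ ε ^ #(C.inputsIn S t₀ t₁) / 2 := by
        gcongr ?_ / 2
        exact pow_le_pow_of_le_one h0 h1 hinputs
    _ ≤ blockErrorProb ε enc C := pow_card_inputsIn_div_two_le_blockErrorProb h0 h1 enc hpiece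

lemma neg_log_le_mul_pow_of_energy_lt {ε : ℝ} (hε0 : 0 < ε) (hε1 : ε ≤ 1)
    (enc : (Fin k → Bool) → (Fin n → Bool)) {q : ℝ} (hq : blockErrorProb ε enc C < q) {d : ℕ}
    (h : (s + 4) * C.energy < d * k) :
    -Real.log q ≤ (Real.log 2 - Real.log ε) * d ^ 3 := by
  have hd : 1 ≤ d := Nat.pos_of_mul_pos_right (Nat.zero_le _ |>.trans_lt h)
  have hd3 : (1 : ℝ) ≤ d ^ 3 := one_le_pow₀ (by exact_mod_cast hd)
  have hlog := Real.log_le_log (by positivity)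
    ((C.pow_div_two_le_blockErrorProb_of_energy_lt hε0.le hε1 enc h).trans hq.le)
  rw [Real.log_div (by positivity) two_ne_zero, Real.log_pow, Nat.cast_pow] at hlog
  nlinarith [Real.log_pos one_lt_two]

lemma div_add_one_le_mul_energy_div {ρ : ℝ} (hρ : 0 < ρ) (hn : 0 < n) (hk : ρ * n ≤ k) :
    (((s + 4) * C.energy / k + 1 : ℕ) : ℝ) ≤ ((s + 4) / ρ + 1) * (C.energy / n) := by
  have hn' : (0 : ℝ) < n := by exact_mod_cast hn
  have hE : (n : ℝ) ≤ C.energy := by exact_mod_cast C.inputs_le_energy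
  calc (((s + 4) * C.energy / k + 1 : ℕ) : ℝ) ≤ ((s + 4) * C.energy : ℕ) / k + 1 := by
        push_cast
        gcongr
        exact_mod_cast Nat.cast_div_le
    _ ≤ ((s + 4) * C.energy : ℕ) / (ρ * n) + C.energy / n := by
        gcongr
        exact (one_le_div hn').2 hE
    _ = ((s + 4) / ρ + 1) * (C.energy / n) := by
        push_cast
        field_simp

theorem mul_rpow_neg_log_le_mul_energy {ε : ℝ} (hε0 : 0 < ε) (hε1 : ε ≤ 1)
    (enc : (Fin k → Bool) → (Fin n → Bool)) {q ρ α : ℝ} (hq : blockErrorProb ε enc C < q)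
    (hq1 : q ≤ 1) (hρ : 0 < ρ) (hn : 0 < n) (hk : ρ * n ≤ k) (hα0 : 0 ≤ α) (hα : α ≤ 1 / 3) :
    n * (-Real.log q) ^ α ≤
      (Real.log 2 - Real.log ε) ^ α * ((s + 4) / ρ + 1) * C.energy := by
  set B := Real.log 2 - Real.log ε
  have hB : 0 ≤ B := sub_nonneg.2 (Real.log_le_log hε0 (hε1.trans one_le_two))
  have hn' : (0 : ℝ) < n := by exact_mod_cast hn
  have hk' : 0 < k := by exact_mod_cast (mul_pos hρ hn').trans_le hk
  set d := (s + 4) * C.energy / k + 1 with hd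
  have henergy : (s + 4) * C.energy < d * k := by
    rw [hd, add_one_mul]
    exact Nat.lt_div_mul_add hk'
  have hq0 : 0 < q := (by positivity : 0 < ε ^ d ^ 3 / 2).trans_le
    ((C.pow_div_two_le_blockErrorProb_of_energy_lt hε0.le hε1 enc henergy).trans hq.le)
  have hd1 : (1 : ℝ) ≤ d := by exact_mod_cast Nat.le_add_left 1 _
  calc n * (-Real.log q) ^ α ≤ n * (B * (d : ℝ) ^ 3) ^ α := by
        gcongr
        · exact neg_nonneg.2 (Real.log_nonpos hq0.le hq1)
        · exact C.neg_log_le_mul_pow_of_energy_lt hε0 hε1 enc hq henergy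
    _ = n * (B ^ α * (d : ℝ) ^ (3 * α)) := by
        rw [Real.mul_rpow hB (by positivity), ← Real.rpow_natCast_mul (by positivity)]
        norm_num
    _ ≤ n * (B ^ α * d) := by
        gcongr
        exact Real.rpow_le_self_of_one_le hd1 (by linarith)
    _ ≤ n * (B ^ α * (((s + 4) / ρ + 1) * (C.energy / n))) := by
        gcongr
        exact C.div_add_one_le_mul_energy_div hρ hn hk
    _ = B ^ α * ((s + 4) / ρ + 1) * C.energy := by field_simp

end Circuit

end VLSI

theorem mainTheorem7_general (s : ℕ) (ε : ℝ) (hε0 : 0 < ε) (hε1 : ε < 1)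
    (f : ℕ → ℝ) (hf : ∀ᶠ n in atTop, f n ≤ 1)
    (D : VLSI.DecodingScheme s) (R : ℝ) (hR : 0 < R) (hrate : D.HasRate R)
    (hD : D.IsErrorScheme ε f) (α : ℝ) (hα0 : 0 ≤ α) (hα : α ≤ 1 / 3) :
    ∃ c : ℝ, 0 < c ∧ ∀ᶠ i in atTop,
      c * ((D.n i : ℝ) * (-Real.log (f (D.n i))) ^ α) ≤ ((D.circuit i).energy : ℝ) := by
  set K := (Real.log 2 - Real.log ε) ^ α * ((s + 4) / (R / 2) + 1)
  have hlog : 0 < Real.log 2 - Real.log ε :=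
    sub_pos.2 (Real.log_lt_log hε0 (hε1.trans one_lt_two))
  have hK : 0 < K := by positivity
  have hn_top := D.n_strictMono.tendsto_atTop
  refine ⟨K⁻¹, inv_pos.2 hK, ?_⟩
  filter_upwards [hD, hn_top.eventually hf, hn_top.eventually_gt_atTop 0,
    hrate.eventually_const_lt (half_lt_self hR)] with i herror hfi hn hrate_i
  have hk : R / 2 * D.n i ≤ D.k i := ((lt_div_iff₀ (by exact_mod_cast hn)).1 hrate_i).le
  rw [inv_mul_le_iff₀ hK]
  exact (D.circuit i).mul_rpow_neg_log_le_mul_energy hε0 hε1.le (D.enc i) herror hfi (half_pos hR)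
    hn hk hα0 hα

theorem mainTheorem7 (s : ℕ) (ε : ℝ) (hε0 : 0 < ε) (hε1 : ε < 1)
    (f : ℕ → ℝ) (hf : ∀ᶠ n in atTop, f n ≤ 1)
    (D : VLSI.DecodingScheme s) (R : ℝ) (hR : 0 < R) (hrate : D.HasRate R)
    (hD : D.IsErrorScheme ε f)
    (hreg : D.OutputRegular) (hout : D.IncreasingOutputNodes) :
    ∃ c : ℝ, 0 < c ∧ ∀ᶠ i in atTop,
      c * ((D.n i : ℝ) * (-Real.log (f (D.n i))) ^ (1 / 5 : ℝ)) ≤ ((D.circuit i).energy : ℝ) :=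
  mainTheorem7_general s ε hε0 hε1 f hf D R hR hrate hD (1 / 5) (by norm_num) (by norm_num)
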